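/- All random variables are real valued. For a random variable $X$ with distribution function $F$, let $F^{-1}(u)=\sup\{x: F(x)\le u\}$, $u\in(0,1)$, and let $Me_X=F^{-1}(1/2)$ be its median. $X$ is symmetric if there is a constant $c$ with $F(c-x)=1-F(c+x)$ for all $x$. $X$ is unimodal if it is absolutely continuous and has a density $f$ whose set of positivity $S_X=\{f>0\}$ is an interval, such that either $S_X=(m,b)$ with $m<b\le\infty$ and $f$ is strictly decreasing on $S_X$, or there is $m\in S_X$ such that $f$ is strictly increasing on $S_X\cap(-\infty,m]$ and strictly decreasing on $S_X\cap[m,\infty)$. If $X$ and $Y$ have distribution functions $F$ and $G$, write $X\le_k Y$ (kurtosis order) if $X$ and $Y$ are symmetric and $x\mapsto G^{-1}(F(x))$ is convex on $\{x: x>Me_X,\ F(x)<1\}$. The differential varentropy of an absolutely continuous $X$ with density $f$ is $V(X)=\mathrm{Var}[-\log f(X)]\in[0,\infty]$, with $V(X)=\infty$ when $\log f(X)$ is not square integrable. Theorem. Let $X$ and $Y$ be symmetric and unimodal random variables. If $X\le_k Y$, then $V(X)\le V(Y)$. For example, if $N$, $L$ and $C$ have, respectively, a normal, a logistic and a Cauchy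 distribution, with arbitrary locations and arbitrary positive scales, then $N\le_k L\le_k C$, and hence $V(N)\le V(L)\le V(C)<\infty$. -/

import Mathlib

open MeasureTheory ProbabilityTheory
open scoped NNReal ENNReal

noncomputable section

/-- The right-continuous inverse `F⁻¹(α) = sup {x : F x ≤ α}`, `α ∈ (0,1)`, of the distribution
function `F` of a law `μ` on `ℝ`. (When the support of `μ` is an interval, the supremum over the
points of the support is the same number.) -/
def quantile (μ : Measure ℝ) (α : ℝ) : ℝ :=
  sSup {x : ℝ | cdf μ x ≤ α}

/-- The median `F⁻¹(1/2)` of a law on `ℝ`. -/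
def median (μ : Measure ℝ) : ℝ :=
  quantile μ (1 / 2)

/-- The law with distribution function `F` is symmetric: there is a constant `m` such that
`F (m - x) = 1 - F (m + x)` for all `x`. -/
def IsSymmetricLaw (μ : Measure ℝ) : Prop :=
  ∃ m : ℝ, ∀ x : ℝ, cdf μ (m - x) = 1 - cdf μ (m + x)

/-- A unimodal density: the set `{f ≠ 0}` is an interval, and either this interval is `(m, b)` with
`m < b ≤ ∞` and `f` is strictly decreasing on it, or the mode `m` belongs to the interval and,
within the interval, `f` is strictly increasing for `x ≤ m` and strictly decreasing for `m ≤ x`. -/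
def IsUnimodalDensity (f : ℝ → ℝ) : Prop :=
  (∀ x, 0 ≤ f x) ∧ (Function.support f).OrdConnected ∧
    ((∃ m : ℝ, (Function.support f = Set.Ioi m ∨
          ∃ b : ℝ, m < b ∧ Function.support f = Set.Ioo m b) ∧
        StrictAntiOn f (Function.support f)) ∨
      (∃ m ∈ Function.support f,
        StrictMonoOn f (Function.support f ∩ Set.Iic m) ∧
        StrictAntiOn f (Function.support f ∩ Set.Ici m)))

/-- The law `μ` on `ℝ` is absolutely continuous and has a unimodal probability density function. -/
def IsUnimodalLaw (μ : Measure ℝ) : Prop :=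
  ∃ f : ℝ → ℝ, Measurable f ∧ IsUnimodalDensity f ∧
    μ = volume.withDensity (fun x => ENNReal.ofReal (f x))

section RandomVariables

variable {Ω Ω' : Type*} [MeasurableSpace Ω] [MeasurableSpace Ω']

/-- `X` is symmetric. -/
def IsSymmetricRV (X : Ω → ℝ) (P : Measure Ω) : Prop :=
  IsSymmetricLaw (P.map X)

/-- `X` is an absolutely continuous random variable with a unimodal density. -/
def IsUnimodalRV (X : Ω → ℝ) (P : Measure Ω) : Prop :=
  IsUnimodalLaw (P.map X)

/-- The kurtosis order `X ≤_k Y`: both are symmetric, and `x ↦ G⁻¹(F(x))` is convex for `x` in the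
support of `X` to the right of the median of `X`. The endpoint of the support, where `F x = 1`, is
left out, because `G⁻¹` is a function on `(0,1)`. -/
def KurtosisLE (X : Ω → ℝ) (P : Measure Ω) (Y : Ω' → ℝ) (Q : Measure Ω') : Prop :=
  IsSymmetricRV X P ∧ IsSymmetricRV Y Q ∧
    ConvexOn ℝ {x : ℝ | median (P.map X) < x ∧ cdf (P.map X) x < 1}
      (fun x => quantile (Q.map Y) (cdf (P.map X) x))

/-- The information content `IC(X) = -log f(X)`, where `f` is the density of `X`. -/
def informationContent (X : Ω → ℝ) (P : Measure Ω) : Ω → ℝ :=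
  fun ω => -Real.log (pdf X P volume (X ω)).toReal

/-- The differential varentropy `V(X) = Var[-log f(X)]`, as an element of `[0, ∞]`. It is `∞`
exactly when `-log f(X)` is not square integrable. -/
def varentropy (X : Ω → ℝ) (P : Measure Ω) : ℝ≥0∞ :=
  evariance (informationContent X P) P

end RandomVariables

/-- The logistic distribution with location `a` and scale `s > 0`. -/
def logisticMeasure (a s : ℝ) : Measure ℝ :=
  volume.withDensity (fun x => ENNReal.ofReal
    (Real.exp (-(x - a) / s) / (s * (1 + Real.exp (-(x - a) / s)) ^ 2)))

end

/-! Let `F`, `G` be the distribution functions and `f`, `g` the densities. With `U` uniform on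
`(0,1)`, `F⁻¹(U)` has the law of `X`, so `V(X)` and `V(Y)` are the variances over `(0,1)` of `φ u =
-log f(F⁻¹ u)` and `ψ u = -log g(G⁻¹ u)`. At `x = F⁻¹ u` the map `G⁻¹ ∘ F` has derivative `f(F⁻¹ u)
/ g(G⁻¹ u) = exp (ψ u - φ u)`. Convexity makes `ψ - φ` nondecreasing on `(1/2, 1)`, and unimodality
with symmetry makes `φ` nondecreasing there. Hence `|φ u - φ v| ≤ |ψ u - ψ v|` (`abs_log_sub_le`),
and symmetry extends this to levels on both sides of `1/2`. A variance is half the mean square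
distance of two independent copies, so it is monotone in these distances
(`evariance_le_of_abs_sub_le`).

No smoothness is needed: a density monotone on each side of a point has countably many
discontinuities, and the corresponding levels form a null set.

The examples are checked by second derivatives of `G⁻¹ ∘ F`, through explicit logistic and Cauchy
quantiles. -/

noncomputable section

open Set Filter Topology

/-! ### Distribution functions of laws with a density -/

section Density

variable {μ : Measure ℝ} [IsProbabilityMeasure μ] {f : ℝ → ℝ}

lemma integrable_of_eq_withDensity (hf : Measurable f) (h0 : ∀ x, 0 ≤ f x)
    (hμ : μ = volume.withDensity (fun x => ENNReal.ofReal (f x))) : Integrable f := by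
  refine ⟨hf.aestronglyMeasurable, ?_⟩
  rw [hasFiniteIntegral_iff_ofReal (ae_of_all _ h0)]
  have h : μ univ = 1 := measure_univ
  rw [hμ, withDensity_apply _ MeasurableSet.univ, Measure.restrict_univ] at h
  rw [h]; exact ENNReal.one_lt_top

lemma cdf_eq_setIntegral (hf : Measurable f) (h0 : ∀ x, 0 ≤ f x)
    (hμ : μ = volume.withDensity (fun x => ENNReal.ofReal (f x))) (x : ℝ) :
    cdf μ x = ∫ t in Iic x, f t := by
  rw [cdf_eq_real, integral_eq_lintegral_of_nonneg_ae (ae_of_all _ h0)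
    hf.aestronglyMeasurable, Measure.real]
  conv_lhs => rw [hμ]
  rw [withDensity_apply _ measurableSet_Iic]

lemma cdf_sub_eq_intervalIntegral (hf : Measurable f) (h0 : ∀ x, 0 ≤ f x)
    (hμ : μ = volume.withDensity (fun x => ENNReal.ofReal (f x))) (x y : ℝ) :
    cdf μ y - cdf μ x = ∫ t in x..y, f t := by
  have hi := integrable_of_eq_withDensity hf h0 hμ
  rw [cdf_eq_setIntegral hf h0 hμ, cdf_eq_setIntegral hf h0 hμ,
    intervalIntegral.integral_Iic_sub_Iic hi.integrableOn hi.integrableOn]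

lemma hasDerivAt_cdf (hf : Measurable f) (h0 : ∀ x, 0 ≤ f x)
    (hμ : μ = volume.withDensity (fun x => ENNReal.ofReal (f x))) {x : ℝ}
    (hx : ContinuousAt f x) : HasDerivAt (cdf μ) (f x) x := by
  have hi := integrable_of_eq_withDensity hf h0 hμ
  have h := intervalIntegral.integral_hasDerivAt_right (a := 0) (b := x) hi.intervalIntegrable
    hf.stronglyMeasurable.stronglyMeasurableAtFilter hx
  have e : (cdf μ : ℝ → ℝ) = fun y => (∫ t in (0 : ℝ)..y, f t) + cdf μ 0 := by
    ext y; rw [← cdf_sub_eq_intervalIntegral hf h0 hμ]; ring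
  rw [e]; exact h.add_const _

lemma continuous_cdf_of_density (hf : Measurable f) (h0 : ∀ x, 0 ≤ f x)
    (hμ : μ = volume.withDensity (fun x => ENNReal.ofReal (f x))) : Continuous (cdf μ) := by
  have hi := integrable_of_eq_withDensity hf h0 hμ
  have e : (cdf μ : ℝ → ℝ) = fun y => (∫ t in (0 : ℝ)..y, f t) + cdf μ 0 := by
    ext y; rw [← cdf_sub_eq_intervalIntegral hf h0 hμ]; ring
  rw [e]
  exact (intervalIntegral.continuous_primitive (fun _ _ => hi.intervalIntegrable) 0).add_const _

/-- If the distribution function has no flat piece through `x`, the quantile function inverts it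
at `x`. -/
lemma quantile_cdf_of_lt {ν : Measure ℝ} {x : ℝ} (h : ∀ y, x < y → cdf ν x < cdf ν y) :
    quantile ν (cdf ν x) = x := by
  have : {y : ℝ | cdf ν y ≤ cdf ν x} = Iic x := by
    ext y
    refine ⟨fun hy => ?_, fun hy => monotone_cdf ν hy⟩
    by_contra hxy
    exact absurd (h y (not_le.1 hxy)) (not_lt.2 hy)
  rw [quantile, this, csSup_Iic]

end Density

/-! ### Quantiles of symmetric unimodal laws -/

/-- `μ` has the density `f`, which increases before `m` and decreases after `m`, and `μ` is
symmetric about `c`. -/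
structure IsSymmUnimodal (μ : Measure ℝ) (f : ℝ → ℝ) (m c : ℝ) : Prop where
  measurable : Measurable f
  nonneg : ∀ x, 0 ≤ f x
  monotoneOn : MonotoneOn f (Iio m)
  antitoneOn : AntitoneOn f (Ioi m)
  eq_withDensity : μ = volume.withDensity (fun x => ENNReal.ofReal (f x))
  symm : ∀ x, cdf μ (c - x) = 1 - cdf μ (c + x)

/-- Off the support `f` vanishes, which preserves weak monotonicity because the support is an
interval. The half-lines are open because for support `(m, b)` the value `f m = 0` lies below the
values just after it. -/
lemma IsUnimodalDensity.exists_monotoneOn_antitoneOn {f : ℝ → ℝ} (hf : IsUnimodalDensity f) :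
    ∃ m, MonotoneOn f (Iio m) ∧ AntitoneOn f (Ioi m) := by
  obtain ⟨h0, hS, h | h⟩ := hf
  · obtain ⟨m, hm, ha⟩ := h
    have hsub : ∀ x ≤ m, f x = 0 := by
      intro x hx
      by_contra hfx
      have hx' : x ∈ Function.support f := hfx
      rcases hm with hm | ⟨b, -, hm⟩
      · rw [hm] at hx'; exact absurd hx' (not_lt.2 hx)
      · rw [hm] at hx'; exact absurd hx'.1 (not_lt.2 hx)
    refine ⟨m, fun x hx y hy _ => ?_, fun x hx y hy hxy => ?_⟩
    · rw [hsub x (le_of_lt hx), hsub y (le_of_lt hy)]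
    · by_cases hfy : f y = 0
      · rw [hfy]; exact h0 x
      have hy' : y ∈ Function.support f := hfy
      have hx' : x ∈ Function.support f := by
        rcases hm with hm | ⟨b, -, hm⟩
        · rw [hm]; exact hx
        · rw [hm] at hy' ⊢; exact ⟨hx, hxy.trans_lt hy'.2⟩
      exact ha.antitoneOn hx' hy' hxy
  · obtain ⟨m, hm, hmono, hanti⟩ := h
    refine ⟨m, fun x hx y hy hxy => ?_, fun x hx y hy hxy => ?_⟩
    · by_cases hfx : f x = 0
      · rw [hfx]; exact h0 y
      have hx' : x ∈ Function.support f := hfx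
      exact hmono.monotoneOn ⟨hx', (mem_Iio.1 hx).le⟩ ⟨hS.out hx' hm ⟨hxy, le_of_lt hy⟩, (mem_Iio.1 hy).le⟩ hxy
    · by_cases hfy : f y = 0
      · rw [hfy]; exact h0 x
      have hy' : y ∈ Function.support f := hfy
      exact hanti.antitoneOn ⟨hS.out hm hy' ⟨le_of_lt hx, hxy⟩, (mem_Ioi.1 hx).le⟩ ⟨hy', (mem_Ioi.1 hy).le⟩ hxy

lemma exists_isSymmUnimodal {μ : Measure ℝ} (hs : IsSymmetricLaw μ) (hu : IsUnimodalLaw μ) :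
    ∃ f m c, IsSymmUnimodal μ f m c := by
  obtain ⟨c, hc⟩ := hs
  obtain ⟨f, hf, hfu, hμ⟩ := hu
  obtain ⟨m, h1, h2⟩ := hfu.exists_monotoneOn_antitoneOn
  exact ⟨f, m, c, hf, hfu.1, h1, h2, hμ, hc⟩

namespace IsSymmUnimodal

variable {μ : Measure ℝ} {f : ℝ → ℝ} {m c : ℝ}

lemma countable_not_continuousAt (h : IsSymmUnimodal μ f m c) :
    {x | ¬ ContinuousAt f x}.Countable := by
  refine ((h.monotoneOn.countable_not_continuousWithinAt.union
    h.antitoneOn.countable_not_continuousWithinAt).union (countable_singleton m)).mono ?_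
  intro x hx
  rcases lt_trichotomy x m with hxm | hxm | hxm
  · exact Or.inl (Or.inl ⟨hxm, fun hc => hx (hc.continuousAt (Iio_mem_nhds hxm))⟩)
  · exact Or.inr hxm
  · exact Or.inl (Or.inr ⟨hxm, fun hc => hx (hc.continuousAt (Ioi_mem_nhds hxm))⟩)

lemma cdf_center (h : IsSymmUnimodal μ f m c) : cdf μ c = 1 / 2 := by
  have := h.symm 0
  simp only [sub_zero, add_zero] at this
  linarith

variable [IsProbabilityMeasure μ]

lemma hasDerivAt_cdf (h : IsSymmUnimodal μ f m c) {x : ℝ} (hx : ContinuousAt f x) :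
    HasDerivAt (cdf μ) (f x) x :=
  _root_.hasDerivAt_cdf h.measurable h.nonneg h.eq_withDensity hx

lemma continuous_cdf (h : IsSymmUnimodal μ f m c) : Continuous (cdf μ) :=
  continuous_cdf_of_density h.measurable h.nonneg h.eq_withDensity

/-- A zero of `f` at `x ≠ m` forces `f = 0` on the whole tail beyond `x`, away from `m`. There the
distribution function would be constant, equal to its limit `0` or `1`. -/
lemma pos_of_cdf_mem (h : IsSymmUnimodal μ f m c) {x : ℝ} (hxm : x ≠ m)
    (hx : cdf μ x ∈ Ioo (0 : ℝ) 1) : 0 < f x := by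
  refine (h.nonneg x).lt_of_ne' fun h0 => ?_
  have key := cdf_sub_eq_intervalIntegral h.measurable h.nonneg h.eq_withDensity
  rcases lt_or_gt_of_ne hxm with hxm | hxm
  · have hz : ∀ y ≤ x, cdf μ y = cdf μ x := by
      intro y hy
      have : cdf μ x - cdf μ y = 0 := by
        rw [key, intervalIntegral.integral_congr (g := fun _ => 0)]
        · simp
        · intro t ht
          rw [uIcc_of_le hy] at ht
          exact le_antisymm (h0 ▸ h.monotoneOn (ht.2.trans_lt hxm) hxm ht.2) (h.nonneg t)
      linarith
    have ht : Tendsto (cdf μ) atBot (𝓝 (cdf μ x)) :=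
      tendsto_const_nhds.congr' ((eventually_le_atBot x).mono fun y hy => (hz y hy).symm)
    have := tendsto_nhds_unique ht (tendsto_cdf_atBot μ)
    exact hx.1.ne' this
  · have hz : ∀ y, x ≤ y → cdf μ y = cdf μ x := by
      intro y hy
      have : cdf μ y - cdf μ x = 0 := by
        rw [key, intervalIntegral.integral_congr (g := fun _ => 0)]
        · simp
        · intro t ht
          rw [uIcc_of_le hy] at ht
          exact le_antisymm (h0 ▸ h.antitoneOn hxm (lt_of_lt_of_le hxm ht.1) ht.1) (h.nonneg t)
      linarith
    have ht : Tendsto (cdf μ) atTop (𝓝 (cdf μ x)) :=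
      tendsto_const_nhds.congr' ((eventually_ge_atTop x).mono fun y hy => (hz y hy).symm)
    have := tendsto_nhds_unique ht (tendsto_cdf_atTop μ)
    exact hx.2.ne this

lemma cdf_lt_cdf (h : IsSymmUnimodal μ f m c) {x y : ℝ} (hx : cdf μ x ∈ Ioo (0 : ℝ) 1)
    (hxy : x < y) : cdf μ x < cdf μ y := by
  refine (monotone_cdf μ hxy.le).lt_of_ne fun heq => ?_
  have hmem : ∀ t ∈ Icc x y, cdf μ t = cdf μ x := fun t ht =>
    le_antisymm (heq ▸ monotone_cdf μ ht.2) (monotone_cdf μ ht.1)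
  have hi := integrable_of_eq_withDensity h.measurable h.nonneg h.eq_withDensity
  have hpos : 0 < ∫ t in x..y, f t := by
    rw [intervalIntegral.integral_of_le hxy.le,
      setIntegral_pos_iff_support_of_nonneg_ae (ae_of_all _ h.nonneg) hi.integrableOn]
    have hsub : Ioc x y \ {m} ⊆ Function.support f ∩ Ioc x y := fun t ht =>
      ⟨(h.pos_of_cdf_mem ht.2 (by rw [hmem t ⟨ht.1.1.le, ht.1.2⟩]; exact hx)).ne', ht.1⟩
    refine lt_of_lt_of_le ?_ (measure_mono hsub)
    rw [measure_sdiff_null (measure_singleton m)]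
    simpa using hxy
  rw [← cdf_sub_eq_intervalIntegral h.measurable h.nonneg h.eq_withDensity] at hpos
  linarith

lemma quantile_cdf (h : IsSymmUnimodal μ f m c) {x : ℝ} (hx : cdf μ x ∈ Ioo (0 : ℝ) 1) :
    quantile μ (cdf μ x) = x :=
  quantile_cdf_of_lt fun _ => h.cdf_lt_cdf hx

lemma cdf_quantile (h : IsSymmUnimodal μ f m c) {u : ℝ} (hu : u ∈ Ioo (0 : ℝ) 1) :
    cdf μ (quantile μ u) = u := by
  obtain ⟨x, hx⟩ : u ∈ range (cdf μ) :=
    mem_range_of_exists_le_of_exists_ge h.continuous_cdf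
      (((tendsto_cdf_atBot μ).eventually_le_const hu.1).exists)
      (((tendsto_cdf_atTop μ).eventually_const_le hu.2).exists)
  rw [← hx, h.quantile_cdf (by rwa [hx])]

lemma quantile_le_iff (h : IsSymmUnimodal μ f m c) {u x : ℝ} (hu : u ∈ Ioo (0 : ℝ) 1) :
    quantile μ u ≤ x ↔ u ≤ cdf μ x := by
  constructor
  · intro hx
    rw [← h.cdf_quantile hu]; exact monotone_cdf μ hx
  · intro hx
    by_contra hlt
    rw [not_le] at hlt
    have h1 : cdf μ x = u := le_antisymm (h.cdf_quantile hu ▸ monotone_cdf μ hlt.le) hx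
    have := h.quantile_cdf (by rwa [h1])
    rw [h1] at this
    exact hlt.ne' this

lemma strictMonoOn_quantile (h : IsSymmUnimodal μ f m c) :
    StrictMonoOn (quantile μ) (Ioo 0 1) := by
  intro u hu v hv huv
  rw [← not_le, h.quantile_le_iff hv, h.cdf_quantile hu]
  exact not_le.2 huv

lemma continuousAt_quantile (h : IsSymmUnimodal μ f m c) {u : ℝ} (hu : u ∈ Ioo (0 : ℝ) 1) :
    ContinuousAt (quantile μ) u := by
  refine h.strictMonoOn_quantile.continuousAt_of_image_mem_nhds (Ioo_mem_nhds hu.1 hu.2) ?_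
  have : quantile μ '' Ioo 0 1 = cdf μ ⁻¹' Ioo 0 1 := by
    ext x
    constructor
    · rintro ⟨v, hv, rfl⟩
      rw [mem_preimage, h.cdf_quantile hv]; exact hv
    · intro hx
      exact ⟨_, hx, h.quantile_cdf hx⟩
  rw [this]
  exact h.continuous_cdf.continuousAt.preimage_mem_nhds
    (by rw [h.cdf_quantile hu]; exact Ioo_mem_nhds hu.1 hu.2)

lemma hasDerivAt_quantile (h : IsSymmUnimodal μ f m c) {u : ℝ} (hu : u ∈ Ioo (0 : ℝ) 1)
    (hc : ContinuousAt f (quantile μ u)) (hm : quantile μ u ≠ m) :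
    HasDerivAt (quantile μ) (f (quantile μ u))⁻¹ u := by
  refine HasDerivAt.of_local_left_inverse (h.continuousAt_quantile hu) (h.hasDerivAt_cdf hc)
    (h.pos_of_cdf_mem hm (by rwa [h.cdf_quantile hu])).ne' ?_
  filter_upwards [Ioo_mem_nhds hu.1 hu.2] with v hv using h.cdf_quantile hv

lemma median_eq (h : IsSymmUnimodal μ f m c) : median μ = c := by
  rw [median, ← h.cdf_center, h.quantile_cdf]
  rw [h.cdf_center]; norm_num

lemma quantile_one_sub (h : IsSymmUnimodal μ f m c) {u : ℝ} (hu : u ∈ Ioo (0 : ℝ) 1) :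
    quantile μ (1 - u) = 2 * c - quantile μ u := by
  have h1 := h.symm (quantile μ u - c)
  rw [add_sub_cancel, h.cdf_quantile hu] at h1
  rw [← h1, h.quantile_cdf]
  · ring
  · rw [h1]; exact ⟨by linarith [hu.2], by linarith [hu.1]⟩

/-- Differentiate `F (2c - x) = 1 - F x`. Continuity at both points is needed because `f` is only
determined almost everywhere. -/
lemma apply_reflect (h : IsSymmUnimodal μ f m c) {x : ℝ} (hx : ContinuousAt f x)
    (hx' : ContinuousAt f (2 * c - x)) : f (2 * c - x) = f x := by
  have h1 := h.hasDerivAt_cdf hx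
  have h2 := (h.hasDerivAt_cdf hx').scomp x ((hasDerivAt_id' x).const_sub (2 * c))
  have e : (cdf μ ∘ fun y => 2 * c - y) = fun y => 1 - cdf μ y := by
    ext y
    have := h.symm (y - c)
    simp only [Function.comp]
    rw [add_sub_cancel] at this
    rw [← this]; congr 1; ring
  rw [e] at h2
  have := h2.unique (h1.const_sub 1)
  simpa using this

/-- The mode `m` is not known to equal the center `c`. If `c < m`, reflecting in `c` moves both
points to the left of `m`, where `f` increases. -/
lemma antitone_right (h : IsSymmUnimodal μ f m c) {x y : ℝ} (hx : ContinuousAt f x)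
    (hx' : ContinuousAt f (2 * c - x)) (hy : ContinuousAt f y)
    (hy' : ContinuousAt f (2 * c - y)) (hcx : c < x) (hxy : x ≤ y) : f y ≤ f x := by
  rcases le_or_gt m c with hmc | hmc
  · exact h.antitoneOn (hmc.trans_lt hcx) (hmc.trans_lt (hcx.trans_le hxy)) hxy
  · rw [← h.apply_reflect hx hx', ← h.apply_reflect hy hy']
    exact h.monotoneOn (show 2 * c - y < m by linarith) (show 2 * c - x < m by linarith)
      (by linarith)

lemma aemeasurable_quantile (h : IsSymmUnimodal μ f m c) :
    AEMeasurable (quantile μ) (volume.restrict (Ioo 0 1)) :=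
  aemeasurable_restrict_of_monotoneOn measurableSet_Ioo h.strictMonoOn_quantile.monotoneOn

instance instIsProbabilityMeasureRestrictIoo :
    IsProbabilityMeasure (volume.restrict (Ioo (0 : ℝ) 1)) := ⟨by simp⟩

/-- By `quantile_le_iff`, the levels whose quantile is at most `x` are those up to `F x`, a set of
length `F x`. -/
lemma map_quantile (h : IsSymmUnimodal μ f m c) :
    (volume.restrict (Ioo (0 : ℝ) 1)).map (quantile μ) = μ := by
  have := Measure.isProbabilityMeasure_map h.aemeasurable_quantile
  refine Measure.ext_of_Iic _ _ fun x => ?_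
  rw [Measure.map_apply_of_aemeasurable h.aemeasurable_quantile measurableSet_Iic, ← ofReal_cdf,
    Measure.restrict_apply₀' measurableSet_Ioo.nullMeasurableSet]
  have : quantile μ ⁻¹' Iic x ∩ Ioo 0 1 = Ioo 0 1 ∩ Iic (cdf μ x) := by
    ext u
    constructor
    · rintro ⟨h1, h2⟩; exact ⟨h2, (h.quantile_le_iff h2).1 h1⟩
    · rintro ⟨h1, h2⟩; exact ⟨(h.quantile_le_iff h1).2 h2, h1⟩
  rw [this]
  refine le_antisymm ?_ ?_
  · calc volume (Ioo 0 1 ∩ Iic (cdf μ x)) ≤ volume (Ioc 0 (cdf μ x)) :=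
        measure_mono fun u hu => ⟨hu.1.1, hu.2⟩
      _ = _ := by simp
  · calc ENNReal.ofReal (cdf μ x) = volume (Ioo 0 (cdf μ x)) := by simp
      _ ≤ volume (Ioo 0 1 ∩ Iic (cdf μ x)) := measure_mono fun u hu =>
          ⟨⟨hu.1, hu.2.trans_le (cdf_le_one μ x)⟩, hu.2.le⟩

/-- The levels at which the quantile function and the density are badly behaved. -/
def exceptional (μ : Measure ℝ) (f : ℝ → ℝ) (m : ℝ) : Set ℝ :=
  Ioo 0 1 ∩ quantile μ ⁻¹' ({x | ¬ ContinuousAt f x} ∪ {m})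

lemma countable_exceptional (h : IsSymmUnimodal μ f m c) : (exceptional μ f m).Countable := by
  have hc := h.countable_not_continuousAt.union (countable_singleton m)
  refine MapsTo.countable_of_injOn (f := quantile μ) (fun u hu => hu.2) ?_ hc
  exact h.strictMonoOn_quantile.injOn.mono inter_subset_left

end IsSymmUnimodal

/-! ### Variance and varentropy -/

section Variance

variable {α : Type*} [MeasurableSpace α] {ρ : Measure α}

lemma integral_sq_sub_const [IsProbabilityMeasure ρ] {φ : α → ℝ} (hφ : MemLp φ 2 ρ) (k : ℝ) :
    ∫ u, (φ u - k) ^ 2 ∂ρ = Var[φ; ρ] + (ρ[φ] - k) ^ 2 := by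
  have h1 := variance_sub_const (μ := ρ) hφ.aestronglyMeasurable k
  have h2 := variance_eq_sub (hφ.sub (memLp_const k))
  have h3 : ∫ u, (φ - fun _ : α => k) u ∂ρ = ρ[φ] - k := by
    simp only [Pi.sub_apply]
    rw [integral_sub (hφ.integrable one_le_two) (integrable_const k)]
    simp
  rw [h3] at h2
  have h4 : Var[φ - fun _ : α => k; ρ] = Var[φ; ρ] := h1
  rw [h4] at h2
  have h5 : ∫ u, (φ u - k) ^ 2 ∂ρ = ∫ u, ((φ - fun _ : α => k) ^ 2) u ∂ρ := rfl
  rw [h5]; linarith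

/-- The variance is monotone in the pairwise distances of the values. -/
lemma evariance_le_of_abs_sub_le [IsProbabilityMeasure ρ] {φ ψ : α → ℝ}
    (hφ : AEStronglyMeasurable φ ρ) (hψ : AEStronglyMeasurable ψ ρ) {s : Set α}
    (hs : ∀ᵐ u ∂ρ, u ∈ s) (h : ∀ u ∈ s, ∀ v ∈ s, |φ u - φ v| ≤ |ψ u - ψ v|) :
    eVar[φ; ρ] ≤ eVar[ψ; ρ] := by
  by_cases hψ2 : MemLp ψ 2 ρ
  swap
  · rw [evariance_eq_top hψ hψ2]; exact le_top
  obtain ⟨v₀, hv₀⟩ := hs.exists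
  -- One base point suffices: `|φ| ≤ |ψ - ψ v₀| + |φ v₀|` almost everywhere.
  have hφ2 : MemLp φ 2 ρ := by
    have h1 : MemLp (fun u => |ψ u - ψ v₀| + |φ v₀|) 2 ρ :=
      ((hψ2.sub (memLp_const (ψ v₀))).abs).add (memLp_const |φ v₀|)
    refine h1.mono hφ ?_
    filter_upwards [hs] with u hu
    rw [Real.norm_eq_abs, Real.norm_eq_abs]
    refine le_trans ?_ (le_abs_self _)
    calc |φ u| = |(φ u - φ v₀) + φ v₀| := by ring_nf
      _ ≤ |φ u - φ v₀| + |φ v₀| := abs_add_le _ _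
      _ ≤ _ := add_le_add (h u hu v₀ hv₀) le_rfl
  rw [← ofReal_variance hφ2, ← ofReal_variance hψ2]
  refine ENNReal.ofReal_le_ofReal ?_
  have hsq : ∀ {χ : α → ℝ}, MemLp χ 2 ρ → ∀ k : ℝ, Integrable (fun u => (χ u - k) ^ 2) ρ :=
    fun hχ k => (hχ.sub (memLp_const k)).integrable_sq
  -- Integrate the squared distances over `u` with `v` fixed; integrating again over `v` then gives
  -- twice the variance on each side, with no product measure.
  have hA : ∀ v ∈ s, Var[φ; ρ] + (φ v - ρ[φ]) ^ 2 ≤ Var[ψ; ρ] + (ψ v - ρ[ψ]) ^ 2 := by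
    intro v hv
    have e1 := integral_sq_sub_const hφ2 (φ v)
    have e2 := integral_sq_sub_const hψ2 (ψ v)
    have : ∫ u, (φ u - φ v) ^ 2 ∂ρ ≤ ∫ u, (ψ u - ψ v) ^ 2 ∂ρ := by
      refine integral_mono_ae (hsq hφ2 _) (hsq hψ2 _) ?_
      filter_upwards [hs] with u hu
      exact sq_le_sq.2 (h u hu v hv)
    rw [e1, e2] at this
    calc _ = Var[φ; ρ] + (ρ[φ] - φ v) ^ 2 := by ring
      _ ≤ _ := this
      _ = _ := by ring
  have hB : ∫ v, (Var[φ; ρ] + (φ v - ρ[φ]) ^ 2) ∂ρ ≤ ∫ v, (Var[ψ; ρ] + (ψ v - ρ[ψ]) ^ 2) ∂ρ :=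
    integral_mono_ae ((integrable_const _).add (hsq hφ2 _)) ((integrable_const _).add (hsq hψ2 _))
      (hs.mono hA)
  rw [integral_add (integrable_const _) (hsq hφ2 _), integral_add (integrable_const _) (hsq hψ2 _),
    integral_sq_sub_const hφ2, integral_sq_sub_const hψ2] at hB
  simp only [integral_const, probReal_univ, smul_eq_mul, one_mul, sub_self] at hB
  linarith

lemma evariance_comp {β : Type*} [MeasurableSpace β] {X : α → β} {g : β → ℝ}
    (hX : AEMeasurable X ρ) (hg : Measurable g) :
    eVar[g ∘ X; ρ] = eVar[g; ρ.map X] := by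
  have h1 : (ρ.map X)[g] = ρ[g ∘ X] := integral_map hX hg.aestronglyMeasurable
  rw [evariance, evariance, h1, lintegral_map' (by fun_prop) hX]
  rfl

/-- `pdf` agrees almost everywhere with any given density, so the monotone representative may be
used. -/
lemma varentropy_eq_evariance {X : α → ℝ} (hX : AEMeasurable X ρ) [IsProbabilityMeasure ρ]
    {f : ℝ → ℝ} (hf : Measurable f) (h0 : ∀ x, 0 ≤ f x)
    (hμ : ρ.map X = volume.withDensity (fun x => ENNReal.ofReal (f x))) :
    varentropy X ρ = eVar[fun x => -Real.log (f x); ρ.map X] := by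
  have h1 : informationContent X ρ = (fun x => -Real.log (pdf X ρ volume x).toReal) ∘ X := rfl
  rw [varentropy, h1, evariance_comp (g := fun x => -Real.log (pdf X ρ volume x).toReal) hX
    ((measurable_pdf X ρ volume).ennreal_toReal.log.neg)]
  refine evariance_congr ?_
  have h2 : pdf X ρ volume =ᵐ[volume] fun x => ENNReal.ofReal (f x) := by
    rw [pdf_def, hμ]
    exact Measure.rnDeriv_withDensity _ (by fun_prop)
  have h3 : ρ.map X ≪ volume := by rw [hμ]; exact withDensity_absolutelyContinuous _ _
  filter_upwards [h3.ae_eq h2] with x hx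
  simp only [hx, ENNReal.toReal_ofReal (h0 x)]

end Variance

/-! ### Comparison of two laws in the kurtosis order -/

namespace IsSymmUnimodal

variable {μ ν : Measure ℝ} {f g : ℝ → ℝ}
  {m c m' c' : ℝ}

/-- The levels at which the quantile function and the density behave well, on both sides of the
center. -/
def regular (μ : Measure ℝ) (f : ℝ → ℝ) (m : ℝ) : Set ℝ :=
  {u | u ∈ Ioo (0 : ℝ) 1 ∧ u ∉ exceptional μ f m ∧ 1 - u ∉ exceptional μ f m}

lemma one_sub_mem_regular {u : ℝ} (hu : u ∈ regular μ f m) : 1 - u ∈ regular μ f m :=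
  ⟨⟨by linarith [hu.1.2], by linarith [hu.1.1]⟩, hu.2.2, by rw [sub_sub_cancel]; exact hu.2.1⟩

lemma continuousAt_of_regular {u : ℝ} (hu : u ∈ regular μ f m) :
    ContinuousAt f (quantile μ u) := by
  by_contra hc
  exact hu.2.1 ⟨hu.1, Or.inl hc⟩

lemma ne_of_regular {u : ℝ} (hu : u ∈ regular μ f m) : quantile μ u ≠ m := fun hc =>
  hu.2.1 ⟨hu.1, Or.inr hc⟩

variable [IsProbabilityMeasure μ] [IsProbabilityMeasure ν]

lemma evariance_neg_log (h : IsSymmUnimodal μ f m c) :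
    eVar[fun x => -Real.log (f x); μ] =
      eVar[fun u => -Real.log (f (quantile μ u)); volume.restrict (Ioo 0 1)] := by
  conv_lhs => rw [← h.map_quantile]
  exact (evariance_comp h.aemeasurable_quantile h.measurable.log.neg).symm

lemma ae_mem_regular (h : IsSymmUnimodal μ f m c) :
    ∀ᵐ u ∂(volume.restrict (Ioo (0 : ℝ) 1)), u ∈ regular μ f m := by
  have h1 : (exceptional μ f m).Countable := h.countable_exceptional
  have h2 : ((fun u : ℝ => 1 - u) ⁻¹' exceptional μ f m).Countable :=
    h1.preimage_of_injOn (sub_right_injective.injOn)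
  filter_upwards [ae_restrict_mem measurableSet_Ioo, ae_restrict_of_ae (h1.ae_notMem volume),
    ae_restrict_of_ae (h2.ae_notMem volume)] with u hu hu1 hu2
  exact ⟨hu, hu1, hu2⟩

lemma continuousAt_reflect_of_regular (h : IsSymmUnimodal μ f m c) {u : ℝ}
    (hu : u ∈ regular μ f m) : ContinuousAt f (2 * c - quantile μ u) := by
  rw [← h.quantile_one_sub hu.1]
  exact continuousAt_of_regular (one_sub_mem_regular hu)

lemma pos_of_regular (h : IsSymmUnimodal μ f m c) {u : ℝ} (hu : u ∈ regular μ f m) :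
    0 < f (quantile μ u) :=
  h.pos_of_cdf_mem (ne_of_regular hu) (by rw [h.cdf_quantile hu.1]; exact hu.1)

lemma apply_quantile_one_sub (h : IsSymmUnimodal μ f m c) {u : ℝ} (hu : u ∈ regular μ f m) :
    f (quantile μ (1 - u)) = f (quantile μ u) := by
  rw [h.quantile_one_sub hu.1]
  exact h.apply_reflect (continuousAt_of_regular hu) (h.continuousAt_reflect_of_regular hu)

/-- Folding at `1/2`: the density at a level depends only on the larger of `u` and `1 - u`, so only
the right half matters. -/
lemma apply_quantile_max (h : IsSymmUnimodal μ f m c) {u : ℝ} (hu : u ∈ regular μ f m) :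
    f (quantile μ (max u (1 - u))) = f (quantile μ u) := by
  rcases max_choice u (1 - u) with h1 | h1 <;> rw [h1]
  exact h.apply_quantile_one_sub hu

lemma lt_quantile (h : IsSymmUnimodal μ f m c) {u : ℝ} (hu : u ∈ Ioo (0 : ℝ) 1)
    (hu2 : 1 / 2 < u) : c < quantile μ u := by
  rw [← not_le, h.quantile_le_iff hu, h.cdf_center]
  exact not_le.2 hu2

lemma abs_log_sub_le (h : IsSymmUnimodal μ f m c) (h' : IsSymmUnimodal ν g m' c')
    (hT : ConvexOn ℝ {x : ℝ | median μ < x ∧ cdf μ x < 1} fun x => quantile ν (cdf μ x))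
    {u v : ℝ} (hu : u ∈ regular μ f m) (hv : v ∈ regular μ f m) (hu' : u ∈ regular ν g m')
    (hv' : v ∈ regular ν g m') (hu2 : 1 / 2 < u) (huv : u < v) :
    |-Real.log (f (quantile μ u)) - -Real.log (f (quantile μ v))| ≤
      |-Real.log (g (quantile ν u)) - -Real.log (g (quantile ν v))| := by
  have hfu := h.pos_of_regular hu
  have hfv := h.pos_of_regular hv
  have hgu := h'.pos_of_regular hu'
  have hgv := h'.pos_of_regular hv'
  have hxy := h.strictMonoOn_quantile hu.1 hv.1 huv
  have hcx := h.lt_quantile hu.1 hu2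
  have hmono : f (quantile μ v) ≤ f (quantile μ u) :=
    h.antitone_right (continuousAt_of_regular hu) (h.continuousAt_reflect_of_regular hu)
      (continuousAt_of_regular hv) (h.continuousAt_reflect_of_regular hv) hcx hxy.le
  have hd : ∀ w, w ∈ regular μ f m → w ∈ regular ν g m' →
      HasDerivAt (fun x => quantile ν (cdf μ x))
        ((g (quantile ν w))⁻¹ * f (quantile μ w)) (quantile μ w) := by
    intro w hw hw'
    refine HasDerivAt.comp (h₂ := quantile ν) _ ?_
      (h.hasDerivAt_cdf (continuousAt_of_regular hw))
    rw [h.cdf_quantile hw.1]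
    exact h'.hasDerivAt_quantile hw.1 (continuousAt_of_regular hw') (ne_of_regular hw')
  have hmem : ∀ w ∈ Ioo (0 : ℝ) 1, c < quantile μ w →
      quantile μ w ∈ {x : ℝ | median μ < x ∧ cdf μ x < 1} := fun w hw hcw =>
    ⟨by rwa [h.median_eq], by rw [h.cdf_quantile hw]; exact hw.2⟩
  have hx := hmem u hu.1 hcx
  have hy := hmem v hv.1 (hcx.trans hxy)
  -- The chord slope separates the two derivatives of the convex map, so differentiability is needed
  -- only at these two points.
  have hle := (hT.le_slope_of_hasDerivAt hx hy hxy (hd u hu hu')).trans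
    (hT.slope_le_of_hasDerivAt hx hy hxy (hd v hv hv'))
  have hlog := Real.log_le_log (by positivity) hle
  rw [Real.log_mul (by positivity) hfu.ne', Real.log_mul (by positivity) hfv.ne', Real.log_inv,
    Real.log_inv] at hlog
  have hlog2 := Real.log_le_log hfv hmono
  -- The sign of the `g` difference comes from `hlog` and `hlog2` together; monotonicity of `g` is
  -- not invoked.
  rw [abs_of_nonpos (by linarith), abs_of_nonpos (by linarith)]
  linarith

lemma evariance_le_of_convexOn (h : IsSymmUnimodal μ f m c) (h' : IsSymmUnimodal ν g m' c')
    (hT : ConvexOn ℝ {x : ℝ | median μ < x ∧ cdf μ x < 1} fun x => quantile ν (cdf μ x)) :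
    eVar[fun x => -Real.log (f x); μ] ≤ eVar[fun x => -Real.log (g x); ν] := by
  rw [h.evariance_neg_log, h'.evariance_neg_log]
  refine evariance_le_of_abs_sub_le
    (h.measurable.log.neg.comp_aemeasurable h.aemeasurable_quantile).aestronglyMeasurable
    (h'.measurable.log.neg.comp_aemeasurable h'.aemeasurable_quantile).aestronglyMeasurable
    -- The level `1/2` is dropped: folding fixes it, and its quantile is the median, outside the
    -- domain of convexity.
    (s := {u | u ∈ regular μ f m ∧ u ∈ regular ν g m' ∧ u ≠ 1 / 2}) ?_ ?_
  · filter_upwards [h.ae_mem_regular, h'.ae_mem_regular,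
      ae_restrict_of_ae (Measure.ae_ne volume (1 / 2 : ℝ))] with u h1 h2 h3
    exact ⟨h1, h2, h3⟩
  · intro u hu v hv
    rw [← h.apply_quantile_max hu.1, ← h.apply_quantile_max hv.1,
      ← h'.apply_quantile_max hu.2.1, ← h'.apply_quantile_max hv.2.1]
    have hmax : ∀ w, (w ∈ regular μ f m ∧ w ∈ regular ν g m' ∧ w ≠ 1 / 2) →
        max w (1 - w) ∈ regular μ f m ∧ max w (1 - w) ∈ regular ν g m' ∧
          1 / 2 < max w (1 - w) := by
      intro w hw
      rcases lt_or_gt_of_ne hw.2.2 with h1 | h1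
      · rw [max_eq_right (by linarith)]
        exact ⟨one_sub_mem_regular hw.1, one_sub_mem_regular hw.2.1, by linarith⟩
      · rw [max_eq_left (by linarith)]
        exact ⟨hw.1, hw.2.1, h1⟩
    obtain ⟨a1, a2, a3⟩ := hmax u hu
    obtain ⟨b1, b2, b3⟩ := hmax v hv
    generalize max u (1 - u) = u at *
    generalize max v (1 - v) = v at *
    rcases lt_trichotomy u v with huv | rfl | huv
    · exact h.abs_log_sub_le h' hT a1 b1 a2 b2 a3 huv
    · simp
    · rw [abs_sub_comm, abs_sub_comm (-Real.log (g _))]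
      exact h.abs_log_sub_le h' hT b1 a1 b2 a2 b3 huv

end IsSymmUnimodal

/-- For symmetric unimodal random variables, the kurtosis order implies the varentropy order. -/
theorem varentropy_le_of_kurtosisLE {Ω Ω' : Type*} [MeasurableSpace Ω] [MeasurableSpace Ω']
    {P : Measure Ω} [IsProbabilityMeasure P] {Q : Measure Ω'} [IsProbabilityMeasure Q]
    {X : Ω → ℝ} {Y : Ω' → ℝ} (hX : AEMeasurable X P) (hY : AEMeasurable Y Q)
    (hXu : IsUnimodalRV X P) (hYu : IsUnimodalRV Y Q) (hk : KurtosisLE X P Y Q) :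
    varentropy X P ≤ varentropy Y Q := by
  have := Measure.isProbabilityMeasure_map hX
  have := Measure.isProbabilityMeasure_map hY
  obtain ⟨hXs, hYs, hT⟩ := hk
  obtain ⟨f, m, c, h⟩ := exists_isSymmUnimodal hXs hXu
  obtain ⟨g, m', c', h'⟩ := exists_isSymmUnimodal hYs hYu
  rw [varentropy_eq_evariance hX h.measurable h.nonneg h.eq_withDensity,
    varentropy_eq_evariance hY h'.measurable h'.nonneg h'.eq_withDensity]
  exact h.evariance_le_of_convexOn h' hT

/-- `μ` has a continuous positive density `f`, symmetric about `a` and strictly decreasing to the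
right of `a`. -/
structure HasBellDensity (μ : Measure ℝ) (f : ℝ → ℝ) (a : ℝ) : Prop where
  continuous : Continuous f
  pos : ∀ x, 0 < f x
  symm : ∀ x, f (a - x) = f (a + x)
  strictAntiOn : StrictAntiOn f (Ici a)
  eq_withDensity : μ = volume.withDensity (fun x => ENNReal.ofReal (f x))

/-! ### Continuous bell-shaped densities -/

namespace HasBellDensity

variable {μ : Measure ℝ} {f : ℝ → ℝ} {a : ℝ}

lemma isUnimodalLaw (h : HasBellDensity μ f a) : IsUnimodalLaw μ := by
  have hs : Function.support f = univ := by
    ext x; simp [(h.pos x).ne']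
  refine ⟨f, h.continuous.measurable, ⟨fun x => (h.pos x).le, ?_, Or.inr ⟨a, ?_, ?_, ?_⟩⟩,
    h.eq_withDensity⟩
  · rw [hs]; exact ordConnected_univ
  · rw [hs]; exact mem_univ a
  · rw [hs, univ_inter]
    intro x hx y hy hxy
    have e : ∀ z, f z = f (2 * a - z) := fun z => by
      have := h.symm (a - z)
      rw [sub_sub_cancel] at this
      rw [this]; congr 1; ring
    rw [e x, e y]
    have hy' : y ≤ a := hy
    have hx' : x ≤ a := hx
    exact h.strictAntiOn (show a ≤ 2 * a - y by linarith) (show a ≤ 2 * a - x by linarith)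
      (by linarith)
  · rw [hs, univ_inter]
    exact h.strictAntiOn

variable [IsProbabilityMeasure μ]

lemma hasDerivAt_cdf (h : HasBellDensity μ f a) (x : ℝ) : HasDerivAt (cdf μ) (f x) x :=
  _root_.hasDerivAt_cdf h.continuous.measurable (fun x => (h.pos x).le) h.eq_withDensity
    h.continuous.continuousAt

lemma strictMono_cdf (h : HasBellDensity μ f a) : StrictMono (cdf μ) :=
  strictMono_of_deriv_pos fun x => by rw [(h.hasDerivAt_cdf x).deriv]; exact h.pos x

lemma cdf_pos (h : HasBellDensity μ f a) (x : ℝ) : 0 < cdf μ x :=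
  (cdf_nonneg μ (x - 1)).trans_lt (h.strictMono_cdf (by linarith))

lemma cdf_lt_one (h : HasBellDensity μ f a) (x : ℝ) : cdf μ x < 1 :=
  (h.strictMono_cdf (show x < x + 1 by linarith)).trans_le (cdf_le_one μ _)

lemma quantile_cdf (h : HasBellDensity μ f a) (x : ℝ) : quantile μ (cdf μ x) = x :=
  quantile_cdf_of_lt fun _ hy => h.strictMono_cdf hy

/-- The sum `F (a - y) + F (a + y)` has zero derivative by symmetry of `f`, and tends to `1` as `y →
∞`. -/
lemma cdf_reflect (h : HasBellDensity μ f a) (x : ℝ) :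
    cdf μ (a - x) = 1 - cdf μ (a + x) := by
  have hd : ∀ y, HasDerivAt (fun y => cdf μ (a - y) + cdf μ (a + y)) 0 y := by
    intro y
    have h1 := (h.hasDerivAt_cdf (a - y)).comp_const_sub a y
    have h2 := (h.hasDerivAt_cdf (a + y)).comp_const_add a y
    exact (h1.add h2).congr_deriv (by rw [h.symm]; ring)
  have hc : ∀ y, cdf μ (a - y) + cdf μ (a + y) = cdf μ (a - x) + cdf μ (a + x) := fun y =>
    is_const_of_deriv_eq_zero (fun z => (hd z).differentiableAt) (fun z => (hd z).deriv) y x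
  have h1 : Tendsto (fun y => cdf μ (a - y) + cdf μ (a + y)) atTop (𝓝 (0 + 1)) := by
    refine ((tendsto_cdf_atBot μ).comp ?_).add ((tendsto_cdf_atTop μ).comp ?_)
    · exact tendsto_atBot_add_const_left atTop a tendsto_neg_atTop_atBot
    · exact tendsto_atTop_add_const_left atTop a tendsto_id
  have := tendsto_nhds_unique (tendsto_const_nhds.congr fun y => (hc y).symm) h1
  linarith

lemma isSymmetricLaw (h : HasBellDensity μ f a) : IsSymmetricLaw μ := ⟨a, h.cdf_reflect⟩

lemma cdf_center (h : HasBellDensity μ f a) : cdf μ a = 1 / 2 := by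
  have := h.cdf_reflect 0
  rw [sub_zero, add_zero] at this
  linarith

lemma median_eq (h : HasBellDensity μ f a) : median μ = a := by
  rw [median, ← h.cdf_center, h.quantile_cdf]

lemma half_lt_cdf (h : HasBellDensity μ f a) {x : ℝ} (hx : a < x) : 1 / 2 < cdf μ x := by
  rw [← h.cdf_center]; exact h.strictMono_cdf hx

lemma setOf_median_lt (h : HasBellDensity μ f a) :
    {x : ℝ | median μ < x ∧ cdf μ x < 1} = Ioi a := by
  ext x
  simp [h.median_eq, h.cdf_lt_one x]

lemma cdf_eq_of_hasDerivAt (h : HasBellDensity μ f a) {G : ℝ → ℝ}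
    (hG : ∀ x, HasDerivAt G (f x) x) (h0 : Tendsto G atBot (𝓝 0)) (x : ℝ) : cdf μ x = G x := by
  have hd : ∀ y, HasDerivAt (fun y => cdf μ y - G y) 0 y := fun y => by
    simpa using (h.hasDerivAt_cdf y).fun_sub (hG y)
  have hc : ∀ y, cdf μ y - G y = cdf μ x - G x := fun y =>
    is_const_of_deriv_eq_zero (fun z => (hd z).differentiableAt) (fun z => (hd z).deriv) y x
  have h1 := (tendsto_cdf_atBot μ).sub h0
  have := tendsto_nhds_unique (tendsto_const_nhds.congr fun y => (hc y).symm) h1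
  linarith

/-- `F` is concave on `[a, ∞)`, so the slope of its chord from `(a, 1/2)` is nonincreasing; the
denominators are cleared. -/
lemma mul_cdf_le_mul_cdf (h : HasBellDensity μ f a) {x t : ℝ} (hx : a < x) (hxt : x ≤ t) :
    (x - a) * (2 * cdf μ t - 1) ≤ (t - a) * (2 * cdf μ x - 1) := by
  have hconc : ConcaveOn ℝ (Ici a) (cdf μ) := by
    refine AntitoneOn.concaveOn_of_deriv (convex_Ici a)
      (fun y _ => (h.hasDerivAt_cdf y).continuousAt.continuousWithinAt)
      (fun y _ => (h.hasDerivAt_cdf y).differentiableAt.differentiableWithinAt) ?_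
    have : deriv (cdf μ) = f := funext fun y => (h.hasDerivAt_cdf y).deriv
    rw [this]
    exact h.strictAntiOn.antitoneOn.mono interior_subset
  have hta : 0 < t - a := by linarith
  have := hconc.2 (self_mem_Ici : a ∈ Ici a) (show t ∈ Ici a from hx.le.trans hxt)
    (show 0 ≤ (t - x) / (t - a) from div_nonneg (by linarith) hta.le)
    (show 0 ≤ (x - a) / (t - a) from div_nonneg (by linarith) hta.le) (by field_simp; ring)
  have e : ((t - x) / (t - a)) • a + ((x - a) / (t - a)) • t = x := by
    simp only [smul_eq_mul]; field_simp; ring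
  rw [e, h.cdf_center] at this
  simp only [smul_eq_mul] at this
  have e2 : (t - x) / (t - a) * (1 / 2) + (x - a) / (t - a) * cdf μ t =
    ((t - x) * (1 / 2) + (x - a) * cdf μ t) / (t - a) := by ring
  rw [e2, div_le_iff₀ hta] at this
  linarith

end HasBellDensity

/-! ### Normal, Cauchy and logistic laws -/

lemma hasBellDensity_gaussianReal (a : ℝ) {v : ℝ≥0} (hv : v ≠ 0) :
    HasBellDensity (gaussianReal a v) (gaussianPDFReal a v) a where
  continuous := by unfold gaussianPDFReal; fun_prop
  pos x := gaussianPDFReal_pos a v x hv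
  symm x := by simp [gaussianPDFReal]
  strictAntiOn x hx y hy hxy := by
    have hx' : a ≤ x := hx
    have hv' : (0 : ℝ) < v := by positivity
    unfold gaussianPDFReal
    have : (x - a) ^ 2 < (y - a) ^ 2 := by nlinarith
    gcongr
  eq_withDensity := gaussianReal_of_var_ne_zero a hv

lemma hasBellDensity_cauchyMeasure (a : ℝ) {γ : ℝ≥0} (hγ : γ ≠ 0) :
    HasBellDensity (cauchyMeasure a γ) (cauchyPDFReal a γ) a where
  continuous := by
    have hγ' : (0 : ℝ) < γ := by positivity
    unfold cauchyPDFReal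
    exact continuous_const.mul (Continuous.inv₀ (by fun_prop) fun x => by positivity)
  pos := cauchyPDF_pos a hγ
  symm x := by simp [cauchyPDFReal]
  strictAntiOn x hx y hy hxy := by
    have hx' : a ≤ x := hx
    have hγ' : (0 : ℝ) < γ := by positivity
    unfold cauchyPDFReal
    have : (x - a) ^ 2 < (y - a) ^ 2 := by nlinarith
    gcongr
  eq_withDensity := cauchyMeasure_of_scale_ne_zero a hγ

/-- The density of the logistic distribution. -/
def logisticPDFReal (a s x : ℝ) : ℝ :=
  Real.exp (-(x - a) / s) / (s * (1 + Real.exp (-(x - a) / s)) ^ 2)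

lemma hasBellDensity_logisticMeasure (a : ℝ) {s : ℝ} (hs : 0 < s) :
    HasBellDensity (logisticMeasure a s) (logisticPDFReal a s) a where
  continuous := by
    unfold logisticPDFReal
    exact Continuous.div (by fun_prop) (by fun_prop) fun x => by positivity
  pos x := by unfold logisticPDFReal; positivity
  symm x := by
    have h1 : -(a - x - a) / s = x / s := by ring
    have h2 : -(a + x - a) / s = -(x / s) := by ring
    rw [logisticPDFReal, logisticPDFReal, h1, h2, Real.exp_neg]
    have := Real.exp_pos (x / s)
    field_simp
    ring
  strictAntiOn x hx y hy hxy := by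
    have hx' : a ≤ x := hx
    unfold logisticPDFReal
    have h1 : Real.exp (-(y - a) / s) < Real.exp (-(x - a) / s) := by gcongr
    have h2 : Real.exp (-(x - a) / s) ≤ 1 := by
      rw [Real.exp_le_one_iff]
      exact div_nonpos_of_nonpos_of_nonneg (by linarith) hs.le
    have h3 := Real.exp_pos (-(y - a) / s)
    generalize Real.exp (-(x - a) / s) = p at *
    generalize Real.exp (-(y - a) / s) = q at *
    rw [div_lt_div_iff₀ (by positivity) (by have := h3.trans h1; positivity)]
    -- This is exactly the difference of the two cross products.
    have : 0 < s * ((p - q) * (1 - p * q)) :=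
      mul_pos hs (mul_pos (by linarith) (by nlinarith))
    nlinarith
  eq_withDensity := rfl

lemma cdf_logisticMeasure (a : ℝ) {s : ℝ} (hs : 0 < s) [IsProbabilityMeasure (logisticMeasure a s)]
    (x : ℝ) : cdf (logisticMeasure a s) x = (1 + Real.exp (-(x - a) / s))⁻¹ := by
  refine (hasBellDensity_logisticMeasure a hs).cdf_eq_of_hasDerivAt
    (G := fun x => (1 + Real.exp (-(x - a) / s))⁻¹) (fun y => ?_) ?_ x
  · have h1 : HasDerivAt (fun y => -(y - a) / s) (-1 / s) y :=
      (((hasDerivAt_id' y).sub_const a).neg).div_const s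
    refine ((h1.exp.const_add 1).fun_inv (by positivity)).congr_deriv ?_
    rw [logisticPDFReal]
    field_simp
  · refine Tendsto.inv_tendsto_atTop ?_
    refine tendsto_atTop_add_const_left _ _ (Real.tendsto_exp_atTop.comp ?_)
    refine Tendsto.atTop_div_const hs ?_
    exact tendsto_neg_atBot_atTop.comp (tendsto_atBot_add_const_right _ (-a) tendsto_id)

lemma cdf_cauchyMeasure (a : ℝ) {γ : ℝ≥0} (hγ : γ ≠ 0) (x : ℝ) :
    cdf (cauchyMeasure a γ) x = Real.arctan ((x - a) / γ) / Real.pi + 1 / 2 := by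
  have hγ' : (0 : ℝ) < γ := by positivity
  refine (hasBellDensity_cauchyMeasure a hγ).cdf_eq_of_hasDerivAt
    (G := fun x => Real.arctan ((x - a) / γ) / Real.pi + 1 / 2) (fun y => ?_) ?_ x
  · have h1 : HasDerivAt (fun y => (y - a) / (γ : ℝ)) (1 / γ) y :=
      ((hasDerivAt_id' y).sub_const a).div_const _
    refine ((h1.arctan.div_const Real.pi).add_const (1 / 2)).congr_deriv ?_
    rw [cauchyPDFReal]
    field_simp
    ring
  · have h1 : Tendsto (fun x : ℝ => (x - a) / (γ : ℝ)) atBot atBot :=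
      Tendsto.atBot_div_const hγ' (tendsto_atBot_add_const_right _ (-a) tendsto_id)
    have h2 := (((Real.tendsto_arctan_atBot.mono_right nhdsWithin_le_nhds).comp h1).div_const
      Real.pi).add_const (1 / 2)
    have e : -(Real.pi / 2) / Real.pi + 1 / 2 = 0 := by field_simp; norm_num
    rwa [e] at h2

/-! ### From normal to logistic -/

lemma hasDerivAt_gaussianPDFReal (a : ℝ) (v : ℝ≥0) (x : ℝ) :
    HasDerivAt (gaussianPDFReal a v) (-((x - a) / v) * gaussianPDFReal a v x) x := by
  have h1 : HasDerivAt (fun x : ℝ => -(x - a) ^ 2 / (2 * v)) (-((x - a) / v)) x := by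
    refine (((((hasDerivAt_id' x).sub_const a).fun_pow 2).fun_neg).div_const _).congr_deriv ?_
    rw [show -(((2 : ℕ) : ℝ) * (x - a) ^ (2 - 1) * 1) = 2 * -(x - a) by push_cast; ring,
      mul_div_mul_left _ _ two_ne_zero, neg_div]
  refine (h1.exp.const_mul (√(2 * Real.pi * v))⁻¹).congr_deriv ?_
  rw [gaussianPDFReal]; ring

lemma tendsto_gaussianPDFReal_atTop (a : ℝ) {v : ℝ≥0} (hv : v ≠ 0) :
    Tendsto (gaussianPDFReal a v) atTop (𝓝 0) := by
  have hv' : (0 : ℝ) < v := by positivity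
  have h1 : Tendsto (fun x : ℝ => -(x - a) ^ 2 / (2 * v)) atTop atBot := by
    refine Tendsto.atBot_div_const (by positivity) ?_
    refine tendsto_neg_atTop_atBot.comp ((tendsto_pow_atTop two_ne_zero).comp ?_)
    exact tendsto_atTop_add_const_right _ (-a) tendsto_id
  have h2 := (Real.tendsto_exp_atBot.comp h1).const_mul (√(2 * Real.pi * v))⁻¹
  rw [mul_zero] at h2
  exact h2

/-- The difference has the sign of the second derivative of the log-odds of a normal distribution
function. -/
lemma gaussian_logit_ineq (a : ℝ) {v : ℝ≥0} (hv : v ≠ 0) {x : ℝ} (hx : a < x) :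
    0 ≤ gaussianPDFReal a v x * (2 * cdf (gaussianReal a v) x - 1) -
      (x - a) / v * (cdf (gaussianReal a v) x * (1 - cdf (gaussianReal a v) x)) := by
  have h := hasBellDensity_gaussianReal a hv
  have hv' : (0 : ℝ) < v := by positivity
  set F := cdf (gaussianReal a v) with hF
  set φ := gaussianPDFReal a v with hφ
  have hE : 0 < 2 * F x - 1 := by linarith [h.half_lt_cdf hx]
  -- Freeze `x` in the coefficients and let `t` vary. At `t = x` this function is the required
  -- expression, at infinity it tends to `0`, and it decreases in between by the chord inequality.
  have hd : ∀ t, HasDerivAt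
      (fun t => (2 * F x - 1) * φ t - (x - a) / v * (F t * (1 - F t)))
      (φ t / v * ((x - a) * (2 * F t - 1) - (t - a) * (2 * F x - 1))) t := by
    intro t
    have h1 := h.hasDerivAt_cdf t
    refine (((hasDerivAt_gaussianPDFReal a v t).const_mul (2 * F x - 1)).fun_sub
      ((h1.fun_mul (h1.const_sub 1)).const_mul ((x - a) / v))).congr_deriv ?_
    ring
  have hanti : AntitoneOn
      (fun t => (2 * F x - 1) * φ t - (x - a) / v * (F t * (1 - F t))) (Ici x) := by
    refine antitoneOn_of_deriv_nonpos (convex_Ici x)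
      (fun t _ => (hd t).continuousAt.continuousWithinAt)
      (fun t _ => (hd t).differentiableAt.differentiableWithinAt) fun t ht => ?_
    rw [interior_Ici] at ht
    rw [(hd t).deriv]
    refine mul_nonpos_of_nonneg_of_nonpos (div_nonneg (h.pos t).le hv'.le) ?_
    linarith [h.mul_cdf_le_mul_cdf hx (le_of_lt ht)]
  have hlim : Tendsto (fun t => (2 * F x - 1) * φ t - (x - a) / v * (F t * (1 - F t))) atTop
      (𝓝 ((2 * F x - 1) * 0 - (x - a) / v * (1 * (1 - 1)))) := by
    have h1 := tendsto_cdf_atTop (gaussianReal a v)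
    exact ((tendsto_gaussianPDFReal_atTop a hv).const_mul _).sub
      ((h1.mul (h1.const_sub 1)).const_mul _)
  have := le_of_tendsto hlim ((eventually_ge_atTop x).mono fun t ht =>
    hanti self_mem_Ici ht ht)
  simp only [mul_zero, sub_self] at this
  linarith

lemma convexOn_normal_logistic (a₁ : ℝ) {v : ℝ≥0} (hv : v ≠ 0) (a₂ : ℝ) {s : ℝ} (hs : 0 < s)
    [IsProbabilityMeasure (logisticMeasure a₂ s)] :
    ConvexOn ℝ (Ioi a₁) fun x =>
      quantile (logisticMeasure a₂ s) (cdf (gaussianReal a₁ v) x) := by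
  have h := hasBellDensity_gaussianReal a₁ hv
  have h' := hasBellDensity_logisticMeasure a₂ hs
  set F := cdf (gaussianReal a₁ v) with hF
  set φ := gaussianPDFReal a₁ v with hφ
  -- The logistic quantile is an increasing affine function of the log-odds, so the claim is
  -- convexity of the log-odds of `F`.
  have hq : ∀ x, quantile (logisticMeasure a₂ s) (F x) =
      a₂ + s * (Real.log (F x) - Real.log (1 - F x)) := by
    intro x
    have h0 : 0 < F x := h.cdf_pos x
    have h1 : 0 < 1 - F x := sub_pos.2 (h.cdf_lt_one x)
    rw [← h'.quantile_cdf (a₂ + s * (Real.log (F x) - Real.log (1 - F x)))]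
    congr 1
    rw [cdf_logisticMeasure a₂ hs]
    have e : -(a₂ + s * (Real.log (F x) - Real.log (1 - F x)) - a₂) / s =
        Real.log (1 - F x) - Real.log (F x) := by field_simp; ring
    rw [e, Real.exp_sub, Real.exp_log h0, Real.exp_log h1]
    field_simp
    ring
  have hdF : ∀ x, HasDerivAt F (φ x) x := h.hasDerivAt_cdf
  have hd1 : ∀ x, HasDerivAt (fun x => quantile (logisticMeasure a₂ s) (F x))
      (s * (φ x / (F x * (1 - F x)))) x := by
    intro x
    have h0 : 0 < F x := h.cdf_pos x
    have h1 : 0 < 1 - F x := sub_pos.2 (h.cdf_lt_one x)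
    simp only [hq]
    refine (((((hdF x).log h0.ne').fun_sub (((hdF x).const_sub 1).log h1.ne')).const_mul
      s).const_add a₂).congr_deriv ?_
    field_simp
    ring
  have hd2 : ∀ x, HasDerivAt (fun x => s * (φ x / (F x * (1 - F x))))
      (s * φ x / (F x * (1 - F x)) ^ 2 *
        (φ x * (2 * F x - 1) - (x - a₁) / v * (F x * (1 - F x)))) x := by
    intro x
    have h0 : 0 < F x := h.cdf_pos x
    have h1 : 0 < 1 - F x := sub_pos.2 (h.cdf_lt_one x)
    refine (((hasDerivAt_gaussianPDFReal a₁ v x).fun_div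
      ((hdF x).fun_mul ((hdF x).const_sub 1)) (by positivity)).const_mul s).congr_deriv ?_
    rw [← hφ]
    field_simp
    ring
  refine convexOn_of_hasDerivWithinAt2_nonneg (convex_Ioi a₁)
    (fun x _ => (hd1 x).continuousAt.continuousWithinAt)
    (fun x _ => (hd1 x).hasDerivWithinAt) (fun x _ => (hd2 x).hasDerivWithinAt) fun x hx => ?_
  rw [interior_Ioi] at hx
  exact mul_nonneg (div_nonneg (mul_nonneg hs.le (h.pos x).le) (sq_nonneg _))
    (gaussian_logit_ineq a₁ hv hx)

/-! ### From logistic to Cauchy -/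

lemma convexOn_logistic_cauchy (a₂ : ℝ) {s : ℝ} (hs : 0 < s)
    [IsProbabilityMeasure (logisticMeasure a₂ s)] (a₃ : ℝ) {γ : ℝ≥0} (hγ : γ ≠ 0) :
    ConvexOn ℝ (Ioi a₂) fun x =>
      quantile (cauchyMeasure a₃ γ) (cdf (logisticMeasure a₂ s) x) := by
  have h := hasBellDensity_logisticMeasure a₂ hs
  have h' := hasBellDensity_cauchyMeasure a₃ hγ
  have hγ' : (0 : ℝ) < γ := by positivity
  have hπ := Real.pi_pos
  -- The logistic equation `F' = F (1 - F) / s` keeps all later derivatives in terms of `F` alone.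
  have hdF : ∀ x, HasDerivAt (cdf (logisticMeasure a₂ s))
      (cdf (logisticMeasure a₂ s) x * (1 - cdf (logisticMeasure a₂ s) x) / s) x := by
    intro x
    refine (h.hasDerivAt_cdf x).congr_deriv ?_
    rw [cdf_logisticMeasure a₂ hs, logisticPDFReal]
    field_simp
    ring
  set F := cdf (logisticMeasure a₂ s) with hF
  have hθ : ∀ x, Real.pi * (F x - 1 / 2) ∈ Ioo (-(Real.pi / 2)) (Real.pi / 2) := fun x =>
    ⟨by nlinarith [h.cdf_pos x], by nlinarith [h.cdf_lt_one x]⟩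
  have hcos : ∀ x, 0 < Real.cos (Real.pi * (F x - 1 / 2)) := fun x =>
    Real.cos_pos_of_mem_Ioo (hθ x)
  have hq : ∀ x, quantile (cauchyMeasure a₃ γ) (F x) =
      a₃ + γ * Real.tan (Real.pi * (F x - 1 / 2)) := by
    intro x
    rw [← h'.quantile_cdf (a₃ + γ * Real.tan (Real.pi * (F x - 1 / 2)))]
    congr 1
    rw [cdf_cauchyMeasure a₃ hγ, add_sub_cancel_left, mul_div_cancel_left₀ _ hγ'.ne',
      Real.arctan_tan (hθ x).1 (hθ x).2]
    field_simp
    ring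
  have hdθ : ∀ x, HasDerivAt (fun x => Real.pi * (F x - 1 / 2))
      (Real.pi * (F x * (1 - F x) / s)) x := fun x => ((hdF x).sub_const _).const_mul _
  have hd1 : ∀ x, HasDerivAt (fun x => quantile (cauchyMeasure a₃ γ) (F x))
      (γ * Real.pi / s * (F x * (1 - F x) / Real.cos (Real.pi * (F x - 1 / 2)) ^ 2)) x := by
    intro x
    simp only [hq]
    refine ((((Real.hasDerivAt_tan (hcos x).ne').comp x (hdθ x)).const_mul
      (γ : ℝ)).const_add a₃).congr_deriv ?_
    ring
  have hd2 : ∀ x, HasDerivAt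
      (fun x => γ * Real.pi / s * (F x * (1 - F x) / Real.cos (Real.pi * (F x - 1 / 2)) ^ 2))
      (γ * Real.pi / s ^ 2 * (F x * (1 - F x)) / Real.cos (Real.pi * (F x - 1 / 2)) ^ 3 *
        (2 * Real.pi * (F x * (1 - F x)) * Real.sin (Real.pi * (F x - 1 / 2)) -
          (2 * F x - 1) * Real.cos (Real.pi * (F x - 1 / 2)))) x := by
    intro x
    have hc := hcos x
    refine ((((hdF x).fun_mul ((hdF x).const_sub 1)).fun_div ((hdθ x).cos.fun_pow 2)
      (by positivity)).const_mul _).congr_deriv ?_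
    generalize Real.cos (Real.pi * (F x - 1 / 2)) = C at *
    generalize Real.sin (Real.pi * (F x - 1 / 2)) = S at *
    field_simp
    ring
  refine convexOn_of_hasDerivWithinAt2_nonneg (convex_Ioi a₂)
    (fun x _ => (hd1 x).continuousAt.continuousWithinAt)
    (fun x _ => (hd1 x).hasDerivWithinAt) (fun x _ => (hd2 x).hasDerivWithinAt) fun x hx => ?_
  rw [interior_Ioi] at hx
  have h0 : 0 < F x := h.cdf_pos x
  have h1 : 0 < 1 - F x := sub_pos.2 (h.cdf_lt_one x)
  have h2 : 1 / 2 < F x := h.half_lt_cdf hx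
  have hc := hcos x
  refine mul_nonneg (by positivity) ?_
  have hθ0 : 0 ≤ Real.pi * (F x - 1 / 2) := mul_nonneg hπ.le (by linarith)
  -- With `θ = π (F x - 1/2)`, use `sin θ ≥ 2θ/π` and `cos θ ≤ π/2 - θ`. The second-derivative
  -- factor is then at least `π (1 - F x) (2 F x - 1) ^ 2`.
  have hsin : 2 * F x - 1 ≤ Real.sin (Real.pi * (F x - 1 / 2)) := by
    refine le_trans (le_of_eq ?_) (Real.mul_le_sin hθ0 (hθ x).2.le)
    field_simp
  have hcos' : Real.cos (Real.pi * (F x - 1 / 2)) ≤ Real.pi * (1 - F x) := by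
    rw [← Real.sin_pi_div_two_sub]
    refine (Real.sin_le (by linarith [(hθ x).2])).trans (le_of_eq ?_)
    ring
  have hF1 : 0 < 2 * F x - 1 := by linarith
  have k1 : 2 * Real.pi * (F x * (1 - F x)) * (2 * F x - 1) ≤
      2 * Real.pi * (F x * (1 - F x)) * Real.sin (Real.pi * (F x - 1 / 2)) :=
    mul_le_mul_of_nonneg_left hsin (by positivity)
  have k2 : (2 * F x - 1) * Real.cos (Real.pi * (F x - 1 / 2)) ≤
      (2 * F x - 1) * (Real.pi * (1 - F x)) := mul_le_mul_of_nonneg_left hcos' hF1.le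
  have k3 : 0 ≤ Real.pi * (1 - F x) * (2 * F x - 1) * (2 * F x - 1) := by positivity
  linarith

/-! ### Finite varentropy of the Cauchy law -/

lemma integrable_log_sq_div_one_add_sq :
    Integrable fun z : ℝ => (1 + z ^ 2)⁻¹ * Real.log (1 + z ^ 2) ^ 2 := by
  have hint : Integrable fun z : ℝ => 64 * (1 + ‖z‖ ^ 2) ^ (-(3 / 2 : ℝ) / 2) :=
    (integrable_rpow_neg_one_add_norm_sq (E := ℝ) (r := 3 / 2) (by norm_num)).const_mul 64
  refine hint.mono' (by fun_prop) (ae_of_all _ fun z => ?_)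
  have hy : 1 ≤ 1 + z ^ 2 := by nlinarith
  rw [Real.norm_eq_abs, Real.norm_eq_abs, sq_abs]
  generalize 1 + z ^ 2 = y at *
  have hy0 : 0 < y := by linarith
  have hlog0 := Real.log_nonneg hy
  rw [abs_of_nonneg (by positivity)]
  -- Any exponent below `1/4` would do; `1/8` leaves `y ^ (-3/4)`, which decays like `|z| ^ (-3/2)`.
  have hlog : Real.log y ≤ 8 * y ^ (1 / 8 : ℝ) :=
    (Real.log_le_rpow_div hy0.le (show (0 : ℝ) < 1 / 8 by norm_num)).trans (le_of_eq (by ring))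
  calc y⁻¹ * Real.log y ^ 2 ≤ y⁻¹ * (8 * y ^ (1 / 8 : ℝ)) ^ 2 := by gcongr
    _ = 64 * y ^ (-(3 / 2 : ℝ) / 2) := by
      rw [mul_pow, ← Real.rpow_mul_natCast hy0.le, ← Real.rpow_neg_one, mul_left_comm,
        ← Real.rpow_add hy0]
      norm_num

/-- With `z = (x - a) / γ`, the information content is a constant plus `log (1 + z ^ 2)`. -/
lemma memLp_log_cauchyPDFReal (a : ℝ) {γ : ℝ≥0} (hγ : γ ≠ 0) :
    MemLp (fun x => -Real.log (cauchyPDFReal a γ x)) 2 (cauchyMeasure a γ) := by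
  have hγ' : (0 : ℝ) < γ := by positivity
  have e : (fun x => -Real.log (cauchyPDFReal a γ x)) =
      fun x => -Real.log (Real.pi⁻¹ * (γ : ℝ)⁻¹) + Real.log (1 + ((x - a) / γ) ^ 2) := by
    ext x
    rw [cauchyPDFReal_def', NNReal.coe_inv, Real.log_mul (by positivity) (by positivity),
      Real.log_inv]
    ring
  have hmeas : Measurable fun x : ℝ => Real.log (1 + ((x - a) / γ) ^ 2) := by fun_prop
  have hint : Integrable (fun x : ℝ => Real.log (1 + ((x - a) / γ) ^ 2) ^ 2)
      (cauchyMeasure a γ) := by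
    rw [cauchyMeasure_of_scale_ne_zero a hγ,
      integrable_withDensity_iff_integrable_smul' (measurable_cauchyPDF a γ)
        (ae_of_all _ fun x => ENNReal.ofReal_lt_top)]
    have h1 := ((integrable_log_sq_div_one_add_sq.comp_div hγ'.ne').comp_sub_right a).const_mul
      (Real.pi⁻¹ * (γ : ℝ)⁻¹)
    refine h1.congr (ae_of_all _ fun x => ?_)
    simp only [cauchyPDF, ENNReal.toReal_ofReal (cauchyPDF_pos a hγ x).le, smul_eq_mul]
    rw [cauchyPDFReal_def', NNReal.coe_inv]
    ring
  have hlog := (memLp_two_iff_integrable_sq (μ := cauchyMeasure a γ)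
    hmeas.aestronglyMeasurable).2 hint
  rw [e]
  exact (memLp_const (μ := cauchyMeasure a γ) (-Real.log (Real.pi⁻¹ * (γ : ℝ)⁻¹))).add hlog

/-! ### Transfer to random variables -/

lemma kurtosisLE_of_hasBellDensity {Ω Ω' : Type*} [MeasurableSpace Ω] [MeasurableSpace Ω']
    {P : Measure Ω} {Q : Measure Ω'} {X : Ω → ℝ} {Y : Ω' → ℝ} {μ ν : Measure ℝ}
    [IsProbabilityMeasure μ] [IsProbabilityMeasure ν] {f g : ℝ → ℝ} {a b : ℝ}
    (hX : HasLaw X μ P) (hY : HasLaw Y ν Q) (hf : HasBellDensity μ f a)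
    (hg : HasBellDensity ν g b)
    (hT : ConvexOn ℝ (Ioi a) fun x => quantile ν (cdf μ x)) : KurtosisLE X P Y Q := by
  refine ⟨?_, ?_, ?_⟩
  · rw [IsSymmetricRV, hX.map_eq]; exact hf.isSymmetricLaw
  · rw [IsSymmetricRV, hY.map_eq]; exact hg.isSymmetricLaw
  · rw [hX.map_eq, hY.map_eq, hf.setOf_median_lt]; exact hT

lemma isUnimodalRV_of_hasBellDensity {Ω : Type*} [MeasurableSpace Ω] {P : Measure Ω} {X : Ω → ℝ}
    {μ : Measure ℝ} {f : ℝ → ℝ} {a : ℝ} (hX : HasLaw X μ P) (hf : HasBellDensity μ f a) :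
    IsUnimodalRV X P := by
  rw [IsUnimodalRV, hX.map_eq]; exact hf.isUnimodalLaw

lemma varentropy_cauchy_lt_top {Ω : Type*} [MeasurableSpace Ω] {P : Measure Ω}
    [IsProbabilityMeasure P] {C : Ω → ℝ} {a : ℝ} {γ : ℝ≥0} (hγ : γ ≠ 0)
    (hC : HasLaw C (cauchyMeasure a γ) P) : varentropy C P < ∞ := by
  have h := hasBellDensity_cauchyMeasure a hγ
  rw [varentropy_eq_evariance hC.aemeasurable h.continuous.measurable (fun x => (h.pos x).le)
    (hC.map_eq.trans h.eq_withDensity), hC.map_eq]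
  exact evariance_lt_top (memLp_log_cauchyPDFReal a hγ)

end

theorem mainTheorem4 :
    (∀ {Ω Ω' : Type*} [MeasurableSpace Ω] [MeasurableSpace Ω']
        (P : Measure Ω) [IsProbabilityMeasure P] (Q : Measure Ω') [IsProbabilityMeasure Q]
        (X : Ω → ℝ) (Y : Ω' → ℝ), AEMeasurable X P → AEMeasurable Y Q →
        IsSymmetricRV X P → IsUnimodalRV X P → IsSymmetricRV Y Q → IsUnimodalRV Y Q →
        KurtosisLE X P Y Q → varentropy X P ≤ varentropy Y Q) ∧
    (∀ {Ω₁ Ω₂ Ω₃ : Type*} [MeasurableSpace Ω₁] [MeasurableSpace Ω₂] [MeasurableSpace Ω₃]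
        (P₁ : Measure Ω₁) [IsProbabilityMeasure P₁] (P₂ : Measure Ω₂) [IsProbabilityMeasure P₂]
        (P₃ : Measure Ω₃) [IsProbabilityMeasure P₃]
        (N : Ω₁ → ℝ) (L : Ω₂ → ℝ) (C : Ω₃ → ℝ)
        (a₁ : ℝ) (v : ℝ≥0) (a₂ s : ℝ) (a₃ : ℝ) (γ : ℝ≥0), v ≠ 0 → 0 < s → γ ≠ 0 →
        HasLaw N (gaussianReal a₁ v) P₁ → HasLaw L (logisticMeasure a₂ s) P₂ →
        HasLaw C (cauchyMeasure a₃ γ) P₃ →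
        KurtosisLE N P₁ L P₂ ∧ KurtosisLE L P₂ C P₃ ∧
          varentropy N P₁ ≤ varentropy L P₂ ∧ varentropy L P₂ ≤ varentropy C P₃ ∧
          varentropy C P₃ < ∞) := by
  refine ⟨fun P _ Q _ X Y hX hY _ hXu _ hYu hk => varentropy_le_of_kurtosisLE hX hY hXu hYu hk, ?_⟩
  intro Ω₁ Ω₂ Ω₃ _ _ _ P₁ _ P₂ _ P₃ _ N L C a₁ v a₂ s a₃ γ hv hs hγ hN hL hC
  -- Total mass one is inherited from the law of `L`, so the logistic density need not be
  -- integrated.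
  have hprob : IsProbabilityMeasure (logisticMeasure a₂ s) := by
    rw [← hL.map_eq]; exact Measure.isProbabilityMeasure_map hL.aemeasurable
  have bN := hasBellDensity_gaussianReal a₁ hv
  have bL := hasBellDensity_logisticMeasure a₂ hs
  have bC := hasBellDensity_cauchyMeasure a₃ hγ
  have uN := isUnimodalRV_of_hasBellDensity hN bN
  have uL := isUnimodalRV_of_hasBellDensity hL bL
  have uC := isUnimodalRV_of_hasBellDensity hC bC
  have k₁ := kurtosisLE_of_hasBellDensity hN hL bN bL (convexOn_normal_logistic a₁ hv a₂ hs)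
  have k₂ := kurtosisLE_of_hasBellDensity hL hC bL bC (convexOn_logistic_cauchy a₂ hs a₃ hγ)
  exact ⟨k₁, k₂, varentropy_le_of_kurtosisLE hN.aemeasurable hL.aemeasurable uN uL k₁,
    varentropy_le_of_kurtosisLE hL.aemeasurable hC.aemeasurable uL uC k₂,
    varentropy_cauchy_lt_top hγ hC⟩
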